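/- Define the (extended) harmonic multiset numbers $\left\|{n\atop k}\right\|\in\mathbb{Q}$, for all $n,k\in\mathbb{Z}$, as the unique solution of the recursion $$n\left\|{n\atop k}\right\| = n\left\|{n-1\atop k}\right\| + \left\|{n\atop k-1}\right\| \qquad (n,k\in\mathbb{Z})$$ with the initial conditions $\left\|{n\atop -1}\right\|=\delta_{n,1}$ for all $n \in \mathbb{Z}$ and $\left\|{-1\atop k}\right\|=\delta_{k,1}$ for all $k\in\mathbb{Z}$. Then for all integers $p\geq 0$ and $q\geq 1$ the following series converges and $$\sum_{n=1}^\infty \frac{1}{n^2}\left\|{n\atop p}\right\|\cdot\left\|{-n\atop q}\right\| = \binom{p+q}{p}\,\zeta(p+q+1),$$ where $\zeta$ is the Riemann zeta function. -/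

import Mathlib

namespace HarmonicMultiset

/-- The rows `n ≥ 0` of the array of harmonic multiset numbers. Row `0` vanishes. Row `n + 1` has
the prescribed entry in column `-1`, and the recursion
`N * S N k = N * S (N - 1) k + S N (k - 1)` (with `N = n + 1`) is solved for `S N k` to the right of
that column and for `S N (k - 1)` to its left. -/
def nonnegRow : ℕ → ℤ → ℚ
  | 0, _ => 0
  | n + 1, k =>
    if k = -1 then (if n = 0 then 1 else 0)
    else if 0 ≤ k then nonnegRow n k + nonnegRow (n + 1) (k - 1) / (n + 1)
    else (n + 1) * (nonnegRow (n + 1) (k + 1) - nonnegRow n (k + 1))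
  termination_by n k => (n, (k + 1).natAbs)

/-- The rows below `0`: `negRow m` is row `-(m + 1)`. Row `-1` is prescribed, and each lower row
comes from the recursion solved for `S (N - 1) k` (with `N = -(m + 1)`). -/
def negRow : ℕ → ℤ → ℚ
  | 0, k => if k = 1 then 1 else 0
  | m + 1, k => negRow m k + negRow m (k - 1) / (m + 1)

end HarmonicMultiset

/-- The harmonic multiset number `‖n, k‖` for arbitrary integers `n` and `k`: the unique array with
`n * ‖n, k‖ = n * ‖n - 1, k‖ + ‖n, k - 1‖`, `‖n, -1‖ = δ_{n,1}` and `‖-1, k‖ = δ_{k,1}`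
(see `harmonicMultiset_unique` and the three lemmas before it). -/
def harmonicMultiset : ℤ → ℤ → ℚ
  | Int.ofNat n, k => HarmonicMultiset.nonnegRow n k
  | Int.negSucc m, k => HarmonicMultiset.negRow m k

namespace HarmonicMultiset

lemma nonnegRow_rec (n : ℕ) (k : ℤ) :
    ((n : ℚ) + 1) * nonnegRow (n + 1) k
      = ((n : ℚ) + 1) * nonnegRow n k + nonnegRow (n + 1) (k - 1) := by
  have hn : ((n : ℚ) + 1) ≠ 0 := by positivity
  by_cases hk : 0 ≤ k
  · rw [nonnegRow.eq_2 k n, if_neg (by omega), if_pos hk]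
    field_simp
  · rw [nonnegRow.eq_2 (k - 1) n, if_neg (by omega), if_neg (by omega), sub_add_cancel]
    ring

lemma negRow_of_nonpos (m : ℕ) : ∀ k : ℤ, k ≤ 0 → negRow m k = 0 := by
  induction m with
  | zero => intro k hk; rw [negRow, if_neg (by omega)]
  | succ m ih => intro k hk; rw [negRow, ih k hk, ih (k - 1) (by omega)]; simp

end HarmonicMultiset

open HarmonicMultiset in
theorem harmonicMultiset_rec (n k : ℤ) :
    n * harmonicMultiset n k = n * harmonicMultiset (n - 1) k + harmonicMultiset n (k - 1) := by
  rcases n with (_ | n) | m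
  · have h : harmonicMultiset 0 (k - 1) = 0 := nonnegRow.eq_1 _
    simpa using h.symm
  · have e : Int.ofNat (n + 1) - 1 = Int.ofNat n := by simp
    rw [e]
    simpa [harmonicMultiset] using nonnegRow_rec n k
  · have e : Int.negSucc m - 1 = Int.negSucc (m + 1) := by omega
    have hm : ((m : ℚ) + 1) ≠ 0 := by positivity
    rw [e]
    simp only [harmonicMultiset, negRow, Int.cast_negSucc]
    push_cast
    field_simp
    ring

open HarmonicMultiset in
theorem harmonicMultiset_neg_one_right (n : ℤ) :
    harmonicMultiset n (-1) = if n = 1 then 1 else 0 := by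
  rcases n with (_ | n) | m
  · simp [harmonicMultiset, nonnegRow]
  · have h : Int.ofNat (n + 1) = 1 ↔ n = 0 := by simp
    simp only [h, harmonicMultiset]
    rw [nonnegRow.eq_2, if_pos rfl]
  · rw [if_neg (by omega)]
    exact negRow_of_nonpos m (-1) (by omega)

theorem harmonicMultiset_neg_one_left (k : ℤ) :
    harmonicMultiset (-1) k = if k = 1 then 1 else 0 :=
  HarmonicMultiset.negRow.eq_1 k

/-- The recursion and the two initial conditions determine the harmonic multiset numbers. -/
theorem harmonicMultiset_unique (S : ℤ → ℤ → ℚ)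
    (hrec : ∀ n k : ℤ, n * S n k = n * S (n - 1) k + S n (k - 1))
    (hright : ∀ n : ℤ, S n (-1) = if n = 1 then 1 else 0)
    (hleft : ∀ k : ℤ, S (-1) k = if k = 1 then 1 else 0) :
    S = harmonicMultiset := by
  have key : ∀ D : ℤ → ℤ → ℚ,
      (∀ n k : ℤ, n * D n k = n * D (n - 1) k + D n (k - 1)) →
      (∀ n : ℤ, D n (-1) = 0) → (∀ k : ℤ, D (-1) k = 0) → ∀ n k, D n k = 0 := by
    intro D h1 h2 h3 n
    rcases Int.lt_or_le n 0 with hn | hn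
    · refine Int.leInductionDown (m := -1) (motive := fun n _ => ∀ k, D n k = 0)
        h3 ?_ n (by omega)
      intro n hn ih k
      have h := h1 n k
      have hn0 : (n : ℚ) ≠ 0 := by exact_mod_cast (by omega : n ≠ 0)
      rw [ih, ih] at h
      simpa [hn0] using h.symm
    · refine Int.leInduction (m := 0) (motive := fun n _ => ∀ k, D n k = 0) ?_ ?_ n hn
      · intro k
        have h := h1 0 (k + 1)
        simpa using h.symm
      · intro n hn ih k
        have hn0 : ((n + 1 : ℤ) : ℚ) ≠ 0 := by exact_mod_cast (by omega : n + 1 ≠ 0)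
        have h : ∀ k, ((n + 1 : ℤ) : ℚ) * D (n + 1) k = D (n + 1) (k - 1) := by
          intro k
          have := h1 (n + 1) k
          rwa [add_sub_cancel_right, ih, mul_zero, zero_add] at this
        rcases Int.lt_or_le k (-1) with hk | hk
        · refine Int.leInductionDown (m := -1) (motive := fun k _ => D (n + 1) k = 0)
            (h2 _) ?_ k (by omega)
          intro k _ hk
          rw [← h k, hk, mul_zero]
        · refine Int.leInduction (m := -1) (motive := fun k _ => D (n + 1) k = 0)
            (h2 _) ?_ k hk
          intro k _ hk
          have := h (k + 1)
          rw [add_sub_cancel_right, hk] at this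
          exact (mul_eq_zero.mp this).resolve_left hn0
  funext n k
  refine sub_eq_zero.mp (key (fun n k => S n k - harmonicMultiset n k) ?_ ?_ ?_ n k)
  · intro n k
    linear_combination hrec n k - harmonicMultiset_rec n k
  · intro n
    simp only [hright, harmonicMultiset_neg_one_right, sub_self]
  · intro k
    simp only [hleft, harmonicMultiset_neg_one_left, sub_self]

/-!
For `n ≥ 1` the numbers `‖n, p‖` are the complete homogeneous symmetric polynomials of
`1, 1/2, ..., 1/n`, and the numbers `‖-n, q‖` are the elementary symmetric polynomials, of degree
`q - 1`, of `1, ..., 1/(n - 1)`. Their generating functions are therefore `∏_{j ≤ n} 1 / (1 - x/j)`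
and `∏_{j < n} (1 + y/j)` (`hasSum_nonnegRow`, `hasSum_negRow`). With `a = 1 - x`, multiplying the
left-hand side by `x^p y^(q-1)` and summing over `p` and `q` gives
`B(a) = ∑_{n ≥ 0} (1 + y)_n / ((n + 1) (a)_{n+1})`, where `(a)_n` is the rising factorial.

The right-hand side becomes `∑_{m ≥ 0} 1 / ((a + m) (a + m - y))`, by the negative binomial series
and a geometric series (`tsum_tsum_termRight`). These two functions agree for `0 ≤ y < a`
(`hasSum_one_div_mul`): `B(a) - B(a + 1)` is a telescoping series with sum `1 / (a (a - y))`, and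
`B(a + M) → 0` as `M → ∞`.

All coefficients are nonnegative, so the rearrangements take place in `[0, ∞]`. A power series with
coefficients there is determined by its values on an interval `(0, r]` where it is finite
(`coeff_eq_of_tsum_eq`). Applied first in `x` and then in `y`, this yields the equality of the
coefficients, and with it the convergence of the series.
-/

open Filter Topology
open scoped ENNReal NNReal

namespace HarmonicMultiset

/-! ### Uniqueness of power series with coefficients in `[0, ∞]` -/

lemma coeff_zero_le_of_tsum_le {f g : ℕ → ℝ≥0∞} {r : ℝ≥0} (hr : 0 < r)
    (hle : ∀ x : ℝ≥0, 0 < x → x ≤ r → ∑' p, f p * (x : ℝ≥0∞) ^ p ≤ ∑' p, g p * (x : ℝ≥0∞) ^ p)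
    (hfin : ∑' p, g p * (r : ℝ≥0∞) ^ p ≠ ∞) : f 0 ≤ g 0 := by
  have hr' : (r : ℝ≥0∞) ≠ 0 := by exact_mod_cast hr.ne'
  set G := ∑' p, g (p + 1) * (r : ℝ≥0∞) ^ p with hG
  have hGfin : G ≠ ∞ := by
    rw [tsum_eq_zero_add' ENNReal.summable] at hfin
    have h1 : ∑' p, g (p + 1) * (r : ℝ≥0∞) ^ (p + 1) = G * r := by
      rw [hG, ← ENNReal.tsum_mul_right]
      exact tsum_congr fun p => by ring
    rw [h1] at hfin
    intro h
    rw [h, ENNReal.top_mul hr'] at hfin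
    simp at hfin
  refine ENNReal.le_of_forall_pos_le_add fun ε hε _ => ?_
  lift G to ℝ≥0 using hGfin with G' hG'
  set x : ℝ≥0 := min r (ε / (G' + 1)) with hx
  have hx0 : 0 < x := lt_min hr (by positivity)
  have hxG : x * G' ≤ ε := by
    calc x * G' ≤ ε / (G' + 1) * (G' + 1) := by gcongr; exacts [min_le_right _ _, by simp]
      _ = ε := by field_simp
  calc f 0 ≤ ∑' p, f p * (x : ℝ≥0∞) ^ p := by
        simpa using ENNReal.le_tsum (f := fun p => f p * (x : ℝ≥0∞) ^ p) 0
    _ ≤ ∑' p, g p * (x : ℝ≥0∞) ^ p := hle x hx0 (min_le_left _ _)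
    _ = g 0 + ∑' p, x * (g (p + 1) * (x : ℝ≥0∞) ^ p) := by
        rw [tsum_eq_zero_add' ENNReal.summable]
        simp only [pow_zero, mul_one, pow_succ]
        congr 1
        exact tsum_congr fun p => by ring
    _ ≤ g 0 + x * G' := by
        rw [ENNReal.tsum_mul_left, hG]
        gcongr
        exact min_le_left _ _
    _ ≤ g 0 + ε := by gcongr; exact_mod_cast hxG

/-- Two power series with coefficients in `[0, ∞]` that agree and are finite on `(0, r]` have the
same coefficients. -/
lemma coeff_eq_of_tsum_eq {r : ℝ≥0} (hr : 0 < r) (n : ℕ) : ∀ {f g : ℕ → ℝ≥0∞},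
    (∀ x : ℝ≥0, 0 < x → x ≤ r → ∑' p, f p * (x : ℝ≥0∞) ^ p = ∑' p, g p * (x : ℝ≥0∞) ^ p) →
    (∀ x : ℝ≥0, 0 < x → x ≤ r → ∑' p, g p * (x : ℝ≥0∞) ^ p ≠ ∞) → f n = g n := by
  have zero : ∀ {f g : ℕ → ℝ≥0∞},
    (∀ x : ℝ≥0, 0 < x → x ≤ r → ∑' p, f p * (x : ℝ≥0∞) ^ p = ∑' p, g p * (x : ℝ≥0∞) ^ p) →
    (∀ x : ℝ≥0, 0 < x → x ≤ r → ∑' p, g p * (x : ℝ≥0∞) ^ p ≠ ∞) → f 0 = g 0 := by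
    intro f g h hfin
    refine le_antisymm (coeff_zero_le_of_tsum_le hr (fun x h0 h1 => (h x h0 h1).le)
      (hfin r hr le_rfl)) (coeff_zero_le_of_tsum_le hr (fun x h0 h1 => (h x h0 h1).ge) ?_)
    rw [h r hr le_rfl]
    exact hfin r hr le_rfl
  induction n with
  | zero => exact zero
  | succ n ih =>
    intro f g h hfin
    have split : ∀ (f : ℕ → ℝ≥0∞) (x : ℝ≥0), ∑' p, f p * (x : ℝ≥0∞) ^ p
        = f 0 + x * ∑' p, f (p + 1) * (x : ℝ≥0∞) ^ p := by
      intro f x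
      rw [tsum_eq_zero_add' ENNReal.summable, ← ENNReal.tsum_mul_left]
      simp only [pow_zero, mul_one, pow_succ]
      congr 1
      exact tsum_congr fun p => by ring
    have h0 := zero h hfin
    refine ih (f := fun p => f (p + 1)) (g := fun p => g (p + 1)) (fun x hx hxr => ?_)
      (fun x hx hxr hinf => ?_)
    · have hx' : (x : ℝ≥0∞) ≠ 0 := by exact_mod_cast hx.ne'
      have h1 := h x hx hxr
      have h2 := hfin x hx hxr
      rw [split g] at h2
      rw [split f, split g, h0] at h1
      exact (ENNReal.mul_right_inj hx' ENNReal.coe_ne_top).mp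
        ((ENNReal.add_right_inj (ENNReal.add_ne_top.mp h2).1).mp h1)
    · have hx' : (x : ℝ≥0∞) ≠ 0 := by exact_mod_cast hx.ne'
      refine hfin x hx hxr ?_
      rw [split g, hinf, ENNReal.mul_top hx', add_top]

/-! ### Generating functions of the rows -/

lemma nonnegRow_succ_zero (n : ℕ) : nonnegRow (n + 1) 0 = 1 := by
  induction n with
  | zero => simp [nonnegRow]
  | succ n ih =>
    rw [nonnegRow.eq_2, if_neg (by omega), if_pos le_rfl, ih, nonnegRow.eq_2, if_pos (by omega),
      if_neg (by omega), zero_div, add_zero]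

lemma nonnegRow_succ_succ (n k : ℕ) :
    nonnegRow (n + 1) ((k + 1 : ℕ) : ℤ)
      = nonnegRow n ((k + 1 : ℕ) : ℤ) + nonnegRow (n + 1) (k : ℤ) / (n + 1) := by
  rw [nonnegRow.eq_2, if_neg (by omega), if_pos (by omega)]
  push_cast
  rw [add_sub_cancel_right]

lemma nonnegRow_nonneg (n k : ℕ) : 0 ≤ nonnegRow n (k : ℤ) := by
  induction n generalizing k with
  | zero => simp [nonnegRow]
  | succ n ihn =>
    induction k with
    | zero => exact (nonnegRow_succ_zero n).symm ▸ zero_le_one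
    | succ k ihk =>
      rw [nonnegRow_succ_succ]
      exact add_nonneg (ihn _) (div_nonneg ihk (by positivity))

lemma negRow_nonneg (m : ℕ) (k : ℤ) : 0 ≤ negRow m k := by
  induction m generalizing k with
  | zero => rw [negRow]; split_ifs <;> norm_num
  | succ m ih => rw [negRow]; exact add_nonneg (ih _) (div_nonneg (ih _) (by positivity))

/-- Multiplying a power series with nonnegative coefficients by `1 / (1 - c x)`, at the level of the
recursion for the coefficients. -/
lemma hasSum_div_one_sub {a b : ℕ → ℝ} {c x A : ℝ} (ha : ∀ k, 0 ≤ a k) (hb : ∀ k, 0 ≤ b k)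
    (hx : 0 ≤ x) (hcx : c * x < 1) (h0 : b 0 = a 0)
    (hs : ∀ k, b (k + 1) = a (k + 1) + c * b k) (hA : HasSum (fun k => a k * x ^ k) A) :
    HasSum (fun k => b k * x ^ k) (A / (1 - c * x)) := by
  have hpos : 0 < 1 - c * x := by linarith
  have hrec : ∀ K, ∑ k ∈ Finset.range (K + 1), b k * x ^ k
      = ∑ k ∈ Finset.range (K + 1), a k * x ^ k
        + c * x * ∑ k ∈ Finset.range K, b k * x ^ k := by
    intro K
    rw [Finset.sum_range_succ', Finset.sum_range_succ', h0, Finset.mul_sum, add_right_comm,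
      ← Finset.sum_add_distrib]
    congr 1
    exact Finset.sum_congr rfl fun k _ => by rw [hs]; ring
  have hsum : Summable fun k => b k * x ^ k := by
    refine summable_of_sum_range_le (c := A / (1 - c * x))
      (fun k => mul_nonneg (hb k) (pow_nonneg hx k)) fun K => ?_
    rw [le_div_iff₀ hpos]
    have h1 := hrec K
    have h2 : ∑ k ∈ Finset.range (K + 1), a k * x ^ k ≤ A :=
      sum_le_hasSum _ (fun k _ => mul_nonneg (ha k) (pow_nonneg hx k)) hA
    have h3 := mul_nonneg (hb K) (pow_nonneg hx K)
    rw [Finset.sum_range_succ] at h1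
    linarith
  have h1 := hsum.hasSum
  have h2 : Tendsto (fun K => ∑ k ∈ Finset.range (K + 1), b k * x ^ k) atTop
      (𝓝 (A + c * x * ∑' k, b k * x ^ k)) := by
    simp only [hrec]
    exact ((tendsto_add_atTop_iff_nat 1).mpr hA.tendsto_sum_nat).add
      (h1.tendsto_sum_nat.const_mul _)
  have h3 := tendsto_nhds_unique ((tendsto_add_atTop_iff_nat 1).mpr h1.tendsto_sum_nat) h2
  have h4 : ∑' k, b k * x ^ k = A / (1 - c * x) := by
    rw [eq_div_iff hpos.ne']; linarith
  exact h4 ▸ h1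

lemma hasSum_nonnegRow {x : ℝ} (hx : 0 ≤ x) (hx1 : x < 1) (n : ℕ) :
    HasSum (fun p : ℕ => (nonnegRow (n + 1) (p : ℤ) : ℝ) * x ^ p)
      (∏ j ∈ Finset.range (n + 1), (1 - x / (j + 1)))⁻¹ := by
  induction n with
  | zero =>
    have h : ∀ p : ℕ, nonnegRow 1 (p : ℤ) = 1 := by
      intro p
      induction p with
      | zero => exact nonnegRow_succ_zero 0
      | succ p ih => rw [nonnegRow_succ_succ 0 p, ih]; simp [nonnegRow]
    simpa [h] using hasSum_geometric_of_lt_one hx hx1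
  | succ n ih =>
    have hlt : (1 / ((n + 1 : ℕ) + 1 : ℝ)) * x < 1 := by
      have : (1 / ((n + 1 : ℕ) + 1 : ℝ)) ≤ 1 := by
        rw [div_le_one (by positivity)]; simp; positivity
      calc _ ≤ 1 * x := by gcongr
        _ < 1 := by linarith
    have h := hasSum_div_one_sub (b := fun p : ℕ => (nonnegRow (n + 1 + 1) (p : ℤ) : ℝ))
      (fun k => by exact_mod_cast nonnegRow_nonneg (n + 1) k)
      (fun k => by exact_mod_cast nonnegRow_nonneg (n + 1 + 1) k)
      (c := 1 / ((n + 1 : ℕ) + 1 : ℝ)) hx hlt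
      (by
        simp only [Nat.cast_zero]
        rw [nonnegRow_succ_zero, nonnegRow_succ_zero])
      (fun k => by
        rw [nonnegRow_succ_succ]
        push_cast
        ring) ih
    rw [Finset.prod_range_succ, mul_inv, ← div_eq_mul_inv]
    convert h using 2
    ring

lemma hasSum_negRow (y : ℝ) (m : ℕ) :
    HasSum (fun k : ℕ => (negRow m ((k + 1 : ℕ) : ℤ) : ℝ) * y ^ k)
      (∏ j ∈ Finset.range m, (1 + y / (j + 1))) := by
  induction m with
  | zero =>
    rw [Finset.prod_range_zero]
    convert hasSum_ite_eq (0 : ℕ) (1 : ℝ) using 2 with k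
    rcases k with _ | k
    · simp [negRow]
    · rw [negRow, if_neg (by omega)]; simp
  | succ m ih =>
    rw [Finset.prod_range_succ, mul_add, mul_one]
    have h : HasSum (fun k : ℕ => (negRow m (k : ℤ) : ℝ) / (m + 1) * y ^ k)
        ((∏ j ∈ Finset.range m, (1 + y / (j + 1))) * (y / (m + 1))) := by
      rw [← hasSum_nat_add_iff' 1]
      simp only [Finset.sum_range_one, Nat.cast_zero, negRow_of_nonpos m 0 le_rfl, Rat.cast_zero,
        zero_div, zero_mul, sub_zero]
      have e : (fun k : ℕ => (negRow m ((k + 1 : ℕ) : ℤ) : ℝ) / (m + 1) * y ^ (k + 1))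
          = fun k : ℕ => (negRow m ((k + 1 : ℕ) : ℤ) : ℝ) * y ^ k * (y / (m + 1)) := by
        funext k
        ring
      rw [e]
      exact ih.mul_right _
    convert ih.add h using 2 with k
    rw [negRow]
    push_cast
    rw [add_sub_cancel_right]
    ring

/-! ### The two-variable identity -/

/-- The quotient of rising factorials `(1 + y)_n / (a)_{n + 1}`. -/
noncomputable def risingQuot (a y : ℝ) (n : ℕ) : ℝ :=
  (∏ j ∈ Finset.range n, (1 + y + j)) / ∏ j ∈ Finset.range (n + 1), (a + j)

lemma risingQuot_pos {a y : ℝ} (ha : 0 < a) (hy : 0 ≤ y) (n : ℕ) : 0 < risingQuot a y n :=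
  div_pos (Finset.prod_pos fun j _ => by positivity) (Finset.prod_pos fun j _ => by positivity)

lemma risingQuot_succ (a y : ℝ) (n : ℕ) :
    risingQuot a y (n + 1) = risingQuot a y n * ((1 + y + n) / (a + n + 1)) := by
  rw [risingQuot, risingQuot, Finset.prod_range_succ, Finset.prod_range_succ _ (n + 1)]
  push_cast
  rw [mul_div_mul_comm]
  ring

lemma risingQuot_sub_succ {a : ℝ} (y : ℝ) (ha : 0 < a) (n : ℕ) :
    risingQuot a y n - risingQuot a y (n + 1)
      = (a - y) * (risingQuot a y n / (a + n + 1)) := by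
  rw [risingQuot_succ]
  have : a + n + 1 ≠ 0 := by positivity
  field_simp
  ring

lemma risingQuot_add_one {a : ℝ} (y : ℝ) (ha : 0 < a) (n : ℕ) :
    risingQuot (a + 1) y n = risingQuot a y n * (a / (a + n + 1)) := by
  have h : (∏ j ∈ Finset.range (n + 1), (a + 1 + j)) * a
      = (∏ j ∈ Finset.range (n + 1), (a + j)) * (a + n + 1) := by
    have h1 := Finset.prod_range_succ (fun j : ℕ => a + j) (n + 1)
    rw [Finset.prod_range_succ'] at h1
    push_cast at h1
    rw [add_zero] at h1
    rw [add_assoc, ← h1]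
    congr 1
    exact Finset.prod_congr rfl fun j _ => by ring
  have h2 : ∏ j ∈ Finset.range (n + 1), (a + 1 + j) ≠ 0 :=
    (Finset.prod_pos fun j _ => by positivity).ne'
  have h3 : ∏ j ∈ Finset.range (n + 1), (a + j) ≠ 0 :=
    (Finset.prod_pos fun j _ => by positivity).ne'
  rw [risingQuot, risingQuot, div_mul_div_comm, div_eq_div_iff h2 (by positivity)]
  linear_combination (-∏ j ∈ Finset.range n, (1 + y + j)) * h

/-- The series telescopes because its terms are proportional to differences of `risingQuot`. That
`risingQuot a y n → 0` follows without asymptotics: the limit `l` exists by monotonicity, and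
`l > 0` would make the harmonic series converge. -/
lemma hasSum_risingQuot_div {a y : ℝ} (hy : 0 ≤ y) (hya : y < a) :
    HasSum (fun n : ℕ => risingQuot a y n / (a + n + 1)) (1 / (a * (a - y))) := by
  have ha : 0 < a := hy.trans_lt hya
  have hay : 0 < a - y := sub_pos.mpr hya
  have hpos := risingQuot_pos ha hy
  have hanti : Antitone (risingQuot a y) := antitone_nat_of_succ_le fun n => by
    have h := risingQuot_sub_succ y ha n
    have : 0 ≤ (a - y) * (risingQuot a y n / (a + n + 1)) :=
      mul_nonneg hay.le (div_nonneg (hpos n).le (by positivity))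
    linarith
  have hbdd : BddBelow (Set.range (risingQuot a y)) := ⟨0, by rintro _ ⟨n, rfl⟩; exact (hpos n).le⟩
  obtain ⟨l, hl⟩ : ∃ l, Tendsto (risingQuot a y) atTop (𝓝 l) := ⟨_, tendsto_atTop_ciInf hanti hbdd⟩
  have hzero : risingQuot a y 0 = 1 / a := by simp [risingQuot]
  have hsum : HasSum (fun n : ℕ => risingQuot a y n / (a + n + 1)) ((1 / a - l) / (a - y)) := by
    rw [hasSum_iff_tendsto_nat_of_nonneg fun n => div_nonneg (hpos n).le (by positivity)]
    have h : ∀ N, ∑ n ∈ Finset.range N, risingQuot a y n / (a + n + 1)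
        = (1 / a - risingQuot a y N) / (a - y) := by
      intro N
      rw [eq_div_iff hay.ne', mul_comm, Finset.mul_sum, ← hzero, ← Finset.sum_range_sub']
      exact Finset.sum_congr rfl fun n _ => (risingQuot_sub_succ y ha n).symm
    simp only [h]
    exact (hl.const_sub _).div_const _
  have hl0 : l = 0 := by
    by_contra hne
    have hl' : ∀ n, l ≤ risingQuot a y n := hanti.le_of_tendsto hl
    have hlpos : 0 < l := lt_of_le_of_ne (ge_of_tendsto' hl fun n => (hpos n).le) (Ne.symm hne)
    have hs : Summable fun n : ℕ => (a + 1) / l * (risingQuot a y n / (a + n + 1)) :=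
      hsum.summable.mul_left _
    have hharm : Summable fun n : ℕ => 1 / ((n : ℝ) + 1) := by
      refine Summable.of_nonneg_of_le (fun n => by positivity) (fun n => ?_) hs
      have h1 : 1 / ((n : ℝ) + 1) ≤ (a + 1) / (a + n + 1) := by
        rw [div_le_div_iff₀ (by positivity) (by positivity)]
        nlinarith [mul_nonneg ha.le (Nat.cast_nonneg (α := ℝ) n)]
      calc 1 / ((n : ℝ) + 1) ≤ (a + 1) / (a + n + 1) := h1
        _ = (a + 1) / l * (l / (a + n + 1)) := by field_simp
        _ ≤ _ := by gcongr; exact hl' n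
    have := (summable_nat_add_iff (f := fun n : ℕ => 1 / (n : ℝ)) 1).mp (by simpa using hharm)
    exact Real.not_summable_one_div_natCast this
  convert hsum using 1
  rw [hl0, sub_zero, div_div]

lemma summable_risingQuot {a y : ℝ} (hy : 0 ≤ y) (hya : y < a) :
    Summable fun n : ℕ => risingQuot a y n / (n + 1) := by
  have ha : 0 < a := hy.trans_lt hya
  refine Summable.of_nonneg_of_le
    (fun n => div_nonneg (risingQuot_pos ha hy n).le (by positivity)) (fun n => ?_)
    ((hasSum_risingQuot_div hy hya).summable.mul_left (a + 1))
  have h1 : 1 / ((n : ℝ) + 1) ≤ (a + 1) / (a + n + 1) := by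
    rw [div_le_div_iff₀ (by positivity) (by positivity)]
    nlinarith [mul_nonneg ha.le (Nat.cast_nonneg (α := ℝ) n)]
  calc risingQuot a y n / (n + 1) = risingQuot a y n * (1 / ((n : ℝ) + 1)) := by ring
    _ ≤ risingQuot a y n * ((a + 1) / (a + n + 1)) := by
      gcongr; exact (risingQuot_pos ha hy n).le
    _ = _ := by ring

/-- The shift `a ↦ a + 1` changes the sum by one term of the series on the other side. -/
lemma tsum_risingQuot_eq {a y : ℝ} (hy : 0 ≤ y) (hya : y < a) :
    ∑' n : ℕ, risingQuot a y n / (n + 1)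
      = 1 / (a * (a - y)) + ∑' n : ℕ, risingQuot (a + 1) y n / (n + 1) := by
  have ha : 0 < a := hy.trans_lt hya
  rw [← (hasSum_risingQuot_div hy hya).tsum_eq,
    ← (hasSum_risingQuot_div hy hya).summable.tsum_add (summable_risingQuot hy (by linarith))]
  refine tsum_congr fun n => ?_
  rw [risingQuot_add_one y ha]
  have : a + n + 1 ≠ 0 := by positivity
  field_simp
  ring

lemma risingQuot_add_natCast_le {a y : ℝ} (ha : 0 < a) (hy : 0 ≤ y) (M n : ℕ) :
    risingQuot (a + M) y n ≤ a / (a + M) * risingQuot a y n := by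
  have h : ∏ j ∈ Finset.range n, (a + (j + 1 : ℕ)) ≤ ∏ j ∈ Finset.range n, (a + M + (j + 1 : ℕ)) :=
    Finset.prod_le_prod (fun j _ => by positivity) fun j _ => by
      have := Nat.cast_nonneg (α := ℝ) M
      linarith
  have h1 : 0 < ∏ j ∈ Finset.range n, (a + (j + 1 : ℕ)) :=
    Finset.prod_pos fun j _ => by positivity
  have h2 : 0 ≤ ∏ j ∈ Finset.range n, (1 + y + j) := Finset.prod_nonneg fun j _ => by positivity
  rw [risingQuot, risingQuot, Finset.prod_range_succ', Finset.prod_range_succ']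
  simp only [Nat.cast_zero, add_zero]
  calc _ ≤ (∏ j ∈ Finset.range n, (1 + y + j))
        / ((∏ j ∈ Finset.range n, (a + (j + 1 : ℕ))) * (a + M)) := by gcongr
    _ = _ := by field_simp

lemma hasSum_one_div_mul {a y : ℝ} (hy : 0 ≤ y) (hya : y < a) :
    HasSum (fun m : ℕ => 1 / ((a + m) * (a + m - y)))
      (∑' n : ℕ, risingQuot a y n / (n + 1)) := by
  have ha : 0 < a := hy.trans_lt hya
  have hM : ∀ M : ℕ, y < a + M := fun M => hya.trans_le (by simp)
  set B : ℕ → ℝ := fun M => ∑' n : ℕ, risingQuot (a + M) y n / (n + 1) with hB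
  have hB0 : B 0 = ∑' n : ℕ, risingQuot a y n / (n + 1) := by simp [hB]
  have hstep : ∀ m : ℕ, 1 / ((a + m) * (a + m - y)) = B m - B (m + 1) := by
    intro m
    have := tsum_risingQuot_eq hy (hM m)
    simp only [hB]
    push_cast
    rw [← add_assoc]
    linarith
  have hle : ∀ M, B M ≤ a / (a + M) * B 0 := by
    intro M
    rw [hB0, ← tsum_mul_left]
    refine (summable_risingQuot hy (hM M)).tsum_le_tsum (fun n => ?_)
      ((summable_risingQuot hy hya).mul_left _)
    rw [← mul_div_assoc]
    gcongr
    exact risingQuot_add_natCast_le ha hy M n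
  have hlim : Tendsto B atTop (𝓝 0) := by
    have h1 : Tendsto (fun M : ℕ => a / (a + M) * B 0) atTop (𝓝 (0 * B 0)) :=
      (tendsto_const_nhds.div_atTop
        (tendsto_atTop_add_const_left _ a tendsto_natCast_atTop_atTop)).mul_const _
    rw [zero_mul] at h1
    refine tendsto_of_tendsto_of_tendsto_of_le_of_le tendsto_const_nhds h1 (fun M => ?_) hle
    exact tsum_nonneg fun n =>
      div_nonneg (risingQuot_pos (by positivity) hy n).le (by positivity)
  rw [hasSum_iff_tendsto_nat_of_nonneg fun m =>
    div_nonneg zero_le_one (mul_nonneg (by positivity) (sub_nonneg.mpr (hM m).le))]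
  simp only [hstep, Finset.sum_range_sub', ← hB0]
  simpa using hlim.const_sub (B 0)

/-- The `n`-th generating function of the products on the left-hand side is a quotient of rising
factorials; the index `n` stands for the row `n + 1`. -/
lemma prod_eq_risingQuot {x : ℝ} (y : ℝ) (hx1 : x < 1) (n : ℕ) :
    1 / ((n : ℝ) + 1) ^ 2 * (∏ j ∈ Finset.range (n + 1), (1 - x / (j + 1)))⁻¹
      * (∏ j ∈ Finset.range n, (1 + y / (j + 1))) = risingQuot (1 - x) y n / (n + 1) := by
  have hx' : 0 < 1 - x := by linarith
  induction n with
  | zero => simp [risingQuot]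
  | succ n ih =>
    have h1 : (1 - x + n + 1) ≠ 0 := by positivity
    have h2 : 1 - x / ((n + 1 : ℕ) + 1) = (1 - x + n + 1) / ((n + 1 : ℕ) + 1) := by
      push_cast
      field_simp
      ring
    have h3 : 1 + y / (n + 1) = (1 + y + n) / (n + 1) := by
      field_simp
      ring
    rw [Finset.prod_range_succ _ (n + 1), Finset.prod_range_succ (fun j : ℕ => 1 + y / ((j : ℝ) + 1)) n, mul_inv,
      risingQuot_succ, h2, h3]
    have h4 := (div_eq_iff (by positivity)).mp ih.symm
    rw [h4]
    push_cast
    field_simp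

/-! ### Expansion of both sides and comparison of coefficients -/

lemma tsum_ofReal_eq {f : ℕ → ℝ} {s : ℝ} (hf : ∀ n, 0 ≤ f n) (h : HasSum f s) :
    ∑' n, ENNReal.ofReal (f n) = ENNReal.ofReal s := by
  rw [← h.tsum_eq, ENNReal.ofReal_tsum_of_nonneg hf h.summable]

/-- The `(p, k)`-coefficient of the `n`-th term on the left, where `n` stands for `n + 1` and `k`
for `q - 1`. -/
noncomputable def termLeft (p k n : ℕ) : ℝ :=
  1 / ((n : ℝ) + 1) ^ 2 * (nonnegRow (n + 1) (p : ℤ) : ℝ) * (negRow n ((k + 1 : ℕ) : ℤ) : ℝ)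

/-- The `(p, k)`-coefficient of `1 / ((m + 1 - x) (m + 1 - x - y))`. -/
noncomputable def termRight (p k m : ℕ) : ℝ :=
  ((p + (k + 1)).choose p : ℝ) * (1 / ((m : ℝ) + 1) ^ (p + k + 2))

lemma termLeft_nonneg (p k n : ℕ) : 0 ≤ termLeft p k n := by
  have h1 : (0 : ℝ) ≤ nonnegRow (n + 1) (p : ℤ) := by exact_mod_cast nonnegRow_nonneg (n + 1) p
  have h2 : (0 : ℝ) ≤ negRow n ((k + 1 : ℕ) : ℤ) := by exact_mod_cast negRow_nonneg n _
  rw [termLeft]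
  positivity

lemma termRight_nonneg (p k m : ℕ) : 0 ≤ termRight p k m := by
  rw [termRight]; positivity

lemma tsum_tsum_termLeft {x y : ℝ≥0} (hx1 : x < 1) (n : ℕ) :
    ∑' p, (∑' k, ENNReal.ofReal (termLeft p k n) * (y : ℝ≥0∞) ^ k) * (x : ℝ≥0∞) ^ p
      = ENNReal.ofReal (risingQuot (1 - x) y n / (n + 1)) := by
  have hx1' : (x : ℝ) < 1 := by exact_mod_cast hx1
  rw [← prod_eq_risingQuot (y : ℝ) hx1' n]
  have hH : ∀ p : ℕ, (0 : ℝ) ≤ nonnegRow (n + 1) (p : ℤ) := fun p => by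
    exact_mod_cast nonnegRow_nonneg (n + 1) p
  set Q := ∏ j ∈ Finset.range n, (1 + (y : ℝ) / (j + 1)) with hQ
  have hQ0 : 0 ≤ Q := Finset.prod_nonneg fun j _ => by positivity
  have inner : ∀ p, ∑' k, ENNReal.ofReal (termLeft p k n) * (y : ℝ≥0∞) ^ k
      = ENNReal.ofReal (1 / ((n : ℝ) + 1) ^ 2 * (nonnegRow (n + 1) (p : ℤ) : ℝ) * Q) := by
    intro p
    rw [← tsum_ofReal_eq (fun k => ?_) ((hasSum_negRow y n).mul_left
      (1 / ((n : ℝ) + 1) ^ 2 * (nonnegRow (n + 1) (p : ℤ) : ℝ)))]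
    · refine tsum_congr fun k => ?_
      rw [← ENNReal.ofReal_coe_nnreal, ← ENNReal.ofReal_pow y.coe_nonneg,
        ← ENNReal.ofReal_mul (termLeft_nonneg p k n), termLeft, mul_assoc _ _ ((y : ℝ) ^ k)]
    · rw [← mul_assoc]
      exact mul_nonneg (termLeft_nonneg p k n) (by positivity)
  simp only [inner]
  rw [← tsum_ofReal_eq (fun p => ?_) (((hasSum_nonnegRow x.coe_nonneg hx1' n).mul_left
    (1 / ((n : ℝ) + 1) ^ 2)).mul_right Q)]
  · refine tsum_congr fun p => ?_
    have := hH p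
    rw [← ENNReal.ofReal_coe_nnreal, ← ENNReal.ofReal_pow x.coe_nonneg,
      ← ENNReal.ofReal_mul (by positivity)]
    congr 1
    ring
  · have := hH p
    positivity

lemma tsum_tsum_termRight {x y : ℝ≥0} (hxy : x + y < 1) (m : ℕ) :
    ∑' p, (∑' k, ENNReal.ofReal (termRight p k m) * (y : ℝ≥0∞) ^ k) * (x : ℝ≥0∞) ^ p
      = ENNReal.ofReal (1 / ((1 - x + m) * (1 - x + m - y))) := by
  have hxy' : (x : ℝ) + y < 1 := by exact_mod_cast hxy
  have hx0 := x.coe_nonneg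
  have hy0 := y.coe_nonneg
  have hm : (0 : ℝ) ≤ m := Nat.cast_nonneg m
  have hd : (0 : ℝ) < 1 - x + m := by linarith
  have hd' : (0 : ℝ) < 1 - x + m - y := by linarith
  have hm1 : (0 : ℝ) < (m : ℝ) + 1 := by positivity
  simp_rw [← ENNReal.tsum_mul_right]
  rw [ENNReal.tsum_comm]
  -- the sum over `p` is a negative binomial series
  have inner : ∀ k, ∑' p, ENNReal.ofReal (termRight p k m) * (y : ℝ≥0∞) ^ k * (x : ℝ≥0∞) ^ p
      = ENNReal.ofReal (1 / (1 - x + m) ^ 2 * ((y : ℝ) / (1 - x + m)) ^ k) := by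
    intro k
    have hr : ‖(x : ℝ) / (m + 1)‖ < 1 := by
      rw [Real.norm_of_nonneg (by positivity), div_lt_one hm1]
      linarith
    have h := (hasSum_choose_mul_geometric_of_norm_lt_one (k + 1) hr).mul_left
      ((y : ℝ) ^ k / ((m : ℝ) + 1) ^ (k + 2))
    have hval : (y : ℝ) ^ k / ((m : ℝ) + 1) ^ (k + 2) * (1 / (1 - (x : ℝ) / (m + 1)) ^ (k + 1 + 1))
        = 1 / (1 - x + m) ^ 2 * ((y : ℝ) / (1 - x + m)) ^ k := by
      have : 1 - (x : ℝ) / (m + 1) = (1 - x + m) / (m + 1) := by field_simp; ring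
      rw [this, div_pow, div_pow]
      field_simp
      ring
    rw [hval] at h
    rw [← tsum_ofReal_eq (fun p => by positivity) h]
    refine tsum_congr fun p => ?_
    rw [← ENNReal.ofReal_coe_nnreal, ← ENNReal.ofReal_coe_nnreal, ← ENNReal.ofReal_pow hx0,
      ← ENNReal.ofReal_pow hy0, ← ENNReal.ofReal_mul (termRight_nonneg p k m),
      ← ENNReal.ofReal_mul (mul_nonneg (termRight_nonneg p k m) (by positivity)), termRight,
      Nat.choose_symm_add, div_pow]
    congr 1
    field_simp
    ring
  simp only [inner]
  have hr : (y : ℝ) / (1 - x + m) < 1 := by rw [div_lt_one hd]; linarith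
  have h := (hasSum_geometric_of_lt_one (by positivity) hr).mul_left (1 / (1 - x + m : ℝ) ^ 2)
  rw [tsum_ofReal_eq (fun k => by positivity) h]
  congr 1
  have h1 : 1 - (y : ℝ) / (1 - x + m) = (1 - x + m - y) / (1 - x + m) := by field_simp
  rw [h1]
  field_simp

lemma tsum_termLeft_eq (p k : ℕ) :
    ∑' n, ENNReal.ofReal (termLeft p k n) = ∑' m, ENNReal.ofReal (termRight p k m) := by
  have swap : ∀ (t : ℕ → ℕ → ℕ → ℝ) (x y : ℝ≥0),
      ∑' p, (∑' k, (∑' n, ENNReal.ofReal (t p k n)) * (y : ℝ≥0∞) ^ k) * (x : ℝ≥0∞) ^ p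
        = ∑' n, ∑' p, (∑' k, ENNReal.ofReal (t p k n) * (y : ℝ≥0∞) ^ k) * (x : ℝ≥0∞) ^ p := by
    intro t x y
    rw [ENNReal.tsum_comm]
    refine tsum_congr fun p => ?_
    rw [ENNReal.tsum_mul_right, ENNReal.tsum_comm]
    simp_rw [ENNReal.tsum_mul_right]
  have key : ∀ x y : ℝ≥0, x ≤ 1 / 4 → y ≤ 1 / 4 →
      ∑' p, (∑' k, (∑' n, ENNReal.ofReal (termLeft p k n)) * (y : ℝ≥0∞) ^ k) * (x : ℝ≥0∞) ^ p
        = ∑' p, (∑' k, (∑' m, ENNReal.ofReal (termRight p k m)) * (y : ℝ≥0∞) ^ k)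
            * (x : ℝ≥0∞) ^ p ∧
      ∑' p, (∑' k, (∑' m, ENNReal.ofReal (termRight p k m)) * (y : ℝ≥0∞) ^ k)
            * (x : ℝ≥0∞) ^ p ≠ ∞ := by
    intro x y hx hy
    have hx' : (x : ℝ) ≤ 1 / 4 := by exact_mod_cast hx
    have hy' : (y : ℝ) ≤ 1 / 4 := by exact_mod_cast hy
    have hx1 : x < 1 := by
      rw [← NNReal.coe_lt_coe]; push_cast; linarith
    have hxy : x + y < 1 := by
      rw [← NNReal.coe_lt_coe]; push_cast; linarith
    have hya : (y : ℝ) < 1 - x := by linarith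
    have hB : ∑' n, ENNReal.ofReal (risingQuot (1 - x) y n / (n + 1))
        = ENNReal.ofReal (∑' n : ℕ, risingQuot (1 - x) y n / (n + 1)) :=
      tsum_ofReal_eq (fun n => div_nonneg
        (risingQuot_pos (by linarith) y.coe_nonneg n).le (by positivity))
        (summable_risingQuot y.coe_nonneg hya).hasSum
    have hC : ∑' m : ℕ, ENNReal.ofReal (1 / ((1 - x + m) * (1 - x + m - y)))
        = ENNReal.ofReal (∑' n : ℕ, risingQuot (1 - x) y n / (n + 1)) :=
      tsum_ofReal_eq (fun m => by
        have hm : (0 : ℝ) ≤ m := Nat.cast_nonneg m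
        exact div_nonneg zero_le_one (mul_nonneg (by linarith) (by linarith)))
        (hasSum_one_div_mul y.coe_nonneg hya)
    rw [swap, swap]
    simp_rw [tsum_tsum_termLeft hx1, tsum_tsum_termRight hxy]
    rw [hB, hC]
    exact ⟨rfl, ENNReal.ofReal_ne_top⟩
  have hr : (0 : ℝ≥0) < 1 / 4 := by norm_num
  -- compare coefficients in `x` for fixed `y`, then in `y`
  refine coeff_eq_of_tsum_eq hr k (f := fun k => ∑' n, ENNReal.ofReal (termLeft p k n))
    (g := fun k => ∑' m, ENNReal.ofReal (termRight p k m)) (fun y hy hy1 => ?_)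
    (fun y hy hy1 hinf => ?_)
  · exact coeff_eq_of_tsum_eq hr p
      (f := fun p => ∑' k, (∑' n, ENNReal.ofReal (termLeft p k n)) * (y : ℝ≥0∞) ^ k)
      (g := fun p => ∑' k, (∑' m, ENNReal.ofReal (termRight p k m)) * (y : ℝ≥0∞) ^ k)
      (fun x _ hx1 => (key x y hx1 hy1).1) (fun x _ hx1 => (key x y hx1 hy1).2)
  · have h := ENNReal.ne_top_of_tsum_ne_top (key (1 / 4) y le_rfl hy1).2 p
    refine h ?_
    rw [hinf]
    exact ENNReal.top_mul (pow_ne_zero _ (by simp))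

lemma hasSum_one_div_pow_zeta {s : ℕ} (hs : 1 < s) :
    HasSum (fun m : ℕ => 1 / ((m : ℂ) + 1) ^ s) (riemannZeta s) := by
  have hsum : Summable fun n : ℕ => 1 / (n : ℂ) ^ s := by
    simpa using Complex.summable_one_div_nat_cpow (p := (s : ℂ)) |>.mpr (by simpa using hs)
  have h := hsum.hasSum
  rw [← zeta_nat_eq_tsum_of_gt_one hs, ← hasSum_nat_add_iff' 1] at h
  simpa [show s ≠ 0 by omega] using h

lemma hasSum_termLeft (p k : ℕ) :
    HasSum (fun n => (termLeft p k n : ℂ))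
      (((p + (k + 1)).choose p : ℂ) * riemannZeta ((p + k + 2 : ℕ) : ℂ)) := by
  have hR : HasSum (fun m => (termRight p k m : ℂ))
      (((p + (k + 1)).choose p : ℂ) * riemannZeta ((p + k + 2 : ℕ) : ℂ)) := by
    simpa [termRight] using (hasSum_one_div_pow_zeta (s := p + k + 2) (by omega)).mul_left
      ((p + (k + 1)).choose p : ℂ)
  have hRs : Summable (termRight p k) := Complex.summable_ofReal.mp hR.summable
  have hfin := tsum_termLeft_eq p k
  rw [tsum_ofReal_eq (termRight_nonneg p k) hRs.hasSum] at hfin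
  have hLs : Summable (termLeft p k) := by
    have h := ENNReal.summable_toReal (hfin.trans_ne ENNReal.ofReal_ne_top)
    simpa only [ENNReal.toReal_ofReal (termLeft_nonneg p k _)] using h
  rw [tsum_ofReal_eq (termLeft_nonneg p k) hLs.hasSum,
    ENNReal.ofReal_eq_ofReal_iff (tsum_nonneg (termLeft_nonneg p k))
      (tsum_nonneg (termRight_nonneg p k))] at hfin
  rw [← hR.tsum_eq, ← Complex.ofReal_tsum, ← hfin]
  exact Complex.hasSum_ofReal.mpr hLs.hasSum

end HarmonicMultiset

open HarmonicMultiset in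
theorem proposition5p20 (p q : ℕ) (hq : 1 ≤ q) :
    HasSum
      (fun n : ℕ+ =>
        1 / (n : ℂ) ^ 2 * (harmonicMultiset (n : ℤ) (p : ℤ) : ℂ)
          * (harmonicMultiset (-(n : ℤ)) (q : ℤ) : ℂ))
      (((p + q).choose p : ℂ) * riemannZeta ((p : ℂ) + (q : ℂ) + 1)) := by
  obtain ⟨k, rfl⟩ : ∃ k, q = k + 1 := ⟨q - 1, by omega⟩
  have h := hasSum_termLeft p k
  rw [← Equiv.pnatEquivNat.hasSum_iff] at h
  convert h using 1
  · funext n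
    obtain ⟨m, rfl⟩ := Equiv.pnatEquivNat.symm.surjective n
    have e1 : ((Equiv.pnatEquivNat.symm m : ℕ+) : ℕ) = m + 1 := rfl
    have e2 : -(((m + 1 : ℕ)) : ℤ) = Int.negSucc m := rfl
    have e3 : harmonicMultiset ((m + 1 : ℕ) : ℤ) (p : ℤ) = nonnegRow (m + 1) p := rfl
    rw [Function.comp_apply, Equiv.apply_symm_apply, e1, e2, e3, termLeft, harmonicMultiset]
    push_cast
    rfl
  · push_cast
    ring_nf
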